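/- Two-peg Mastermind with $n$ colours is the following game. The codemaker chooses a secret $(s_1,s_2)\in\{0,\dots,n-1\}^2$. In each round the codebreaker asks a question $(q_1,q_2)\in\{0,\dots,n-1\}^2$, chosen in dependence on the previous answers, and is told the number of black pegs $b=|\{i: s_i=q_i\}|$ and the number of white pegs $w=-b+\sum_{c}\min\{|\{i:s_i=c\}|,|\{i:q_i=c\}|\}$. The game ends with the answer $(b,w)=(2,0)$, and the question that receives this answer is counted. Let $\mathit{MM}_e(2,n)$ be the minimum, over all strategies of the codebreaker that always find the secret, of the expected number of questions for a secret that is uniformly distributed in $\{0,\dots,n-1\}^2$. Then for every $n\ge 3$ the minimum exists and $$\mathit{MM}_e(2,n)=\begin{cases}\dfrac{8n^3+51n^2-74n+48}{24n^2}, & n \text{ even},\\[2ex] \dfrac{8n^3+51n^2-80n+69}{24n^2}, & n\text{ odd}.\end{cases}$$ Moreover, questions that use colours known not to occur in the secret do not help. That is, the minimum expected number of questions has the same value $\mathit{MM}_e(2,n)$ in each of the following two variants of the game: (a) the questions may in addition use one extra colour, which never occurs in the secret; (b) the codebreaker may use in a question only colours that are not yet excluded, that is, colours that occur in at least one position of at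 least one secret consistent with all previous answers. -/

import Mathlib

namespace Mastermind

/-- A code (a secret or a question): `p` pegs, each of which has a colour in `C`. -/
abbrev Code (p : ℕ) (C : Type) : Type := Fin p → C

section Game

variable {p : ℕ} {C : Type} [Fintype C] [DecidableEq C]

/-- The number of black pegs: positions in which the question agrees with the secret. -/
def black (s q : Code p C) : ℕ :=
  (Finset.univ.filter fun i => s i = q i).card

/-- The number of colour matches counted with multiplicity, i.e. black plus white pegs. -/
def colourMatches (s q : Code p C) : ℕ :=
  ∑ c : C, min (Finset.univ.filter fun i => s i = c).card (Finset.univ.filter fun i => q i = c).card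

/-- The number of white pegs. The subtraction does not truncate, see `black_le_colourMatches`. -/
def white (s q : Code p C) : ℕ := colourMatches s q - black s q

theorem black_le_colourMatches (s q : Code p C) : black s q ≤ colourMatches s q := by
  have h : black s q =
      ∑ c : C, ((Finset.univ.filter fun i => s i = q i).filter fun i => s i = c).card :=
    Finset.card_eq_sum_card_fiberwise (fun i _ => Finset.mem_coe.2 (Finset.mem_univ (s i)))
  rw [h]
  refine Finset.sum_le_sum fun c _ => le_min ?_ ?_
  · refine Finset.card_le_card fun i hi => ?_
    simp only [Finset.mem_filter, Finset.mem_univ, true_and] at hi ⊢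
    exact hi.2
  · refine Finset.card_le_card fun i hi => ?_
    simp only [Finset.mem_filter, Finset.mem_univ, true_and] at hi ⊢
    exact hi.1.symm.trans hi.2

/-- The codemaker's answer to the question `q` for the secret `s`: (black pegs, white pegs). -/
def answer (s q : Code p C) : ℕ × ℕ := (black s q, white s q)

/-- A (deterministic, adaptive) strategy of the codebreaker, as a game tree: a node carries the
question that is asked there, and for every answer the subtree with which the game continues.
`halt` asks no question; it stands at the leaves and below answers that cannot occur. -/
inductive GameTree (p : ℕ) (C : Type) : Type
  | halt : GameTree p C
  | ask (q : Code p C) (next : ℕ × ℕ → GameTree p C) : GameTree p C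

/-- The number of questions asked when the codebreaker follows the tree and the secret is `s`: the
game ends with the answer `(p, 0)`, and the last question counts. It is `⊤` if the codebreaker
stops before getting this answer. -/
def questionCount : GameTree p C → Code p C → ℕ∞
  | .halt, _ => ⊤
  | .ask q next, s =>
      if answer s q = (p, 0) then 1 else 1 + questionCount (next (answer s q)) s

/-- The sum of the numbers of questions over all secrets in `M`, that is, the external path length
of the game tree with the set `M` of possible secrets at the root. -/
def externalPathLength (t : GameTree p C) (M : Finset (Code p C)) : ℕ∞ :=
  ∑ s ∈ M, questionCount t s

/-- The expected numbers of questions, for a secret uniformly distributed in `M`, of those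
strategies in `T` that find every secret in `M`. -/
def expectedCounts (M : Finset (Code p C)) (T : Set (GameTree p C)) : Set ℝ :=
  {x | ∃ t ∈ T, ∃ L : ℕ, externalPathLength t M = (L : ℕ∞) ∧ x = (L : ℝ) / (M.card : ℝ)}

/-- All codes whose colours belong to `S`. -/
def codesOver (p : ℕ) (S : Finset C) : Finset (Code p C) := Fintype.piFinset fun _ => S

/-- The colour `c` is not yet excluded when `M` is the set of secrets that are still possible: it
occurs in some position of some secret in `M`. -/
def IsPossibleColour (M : Finset (Code p C)) (c : C) : Prop := ∃ s ∈ M, ∃ j, s j = c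

/-- Starting with the set `M` of possible secrets, the strategy asks, in every game state that can
occur, only questions all of whose colours are not yet excluded in that state. -/
def AvoidsExcluded : GameTree p C → Finset (Code p C) → Prop
  | .halt, _ => True
  | .ask q next, M =>
      (∀ i, IsPossibleColour M (q i)) ∧
      ∀ s ∈ M, answer s q ≠ (p, 0) →
        AvoidsExcluded (next (answer s q)) (M.filter fun s' => answer s' q = answer s q)

end Game

/-- Expected numbers of questions of the strategies for Mastermind with `p` pegs and `n` colours
(every code may be asked at any time). -/
def standardCounts (p n : ℕ) : Set ℝ :=
  expectedCounts (codesOver p (Finset.univ : Finset (Fin n))) Set.univ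

/-- The same when questions may also use one additional colour `none`, which is known not to occur
in the secret. -/
def additionalCounts (p n : ℕ) : Set ℝ :=
  expectedCounts (codesOver p ((Finset.univ : Finset (Option (Fin n))).erase none)) Set.univ

/-- The same for strategies that never use a colour already excluded from the secret. -/
def restrictedCounts (p n : ℕ) : Set ℝ :=
  expectedCounts (codesOver p (Finset.univ : Finset (Fin n)))
    {t | AvoidsExcluded t (codesOver p Finset.univ)}

/-- The minimal expected number of questions in Mastermind with `p` pegs and `n` colours. -/
noncomputable def MMe (p n : ℕ) : ℝ := sInf (standardCounts p n)

end Mastermind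

namespace Mastermind

/-! ### Answers for two pegs, and the external path length as a recursion over the answer classes.
-/

section TwoPegs

/-! The expected count is the external path length divided by the number of secrets, so the minimal
path length is computed, for secrets over any set `S` of `m` colours inside a possibly larger
palette. An answer `(0, 0)` to a question with two distinct possible colours leaves the same game
with `m - 2` colours. One black peg leaves a "cross" (two arms, each fixing the colour of one peg)
with `2m - 2` codes; one white peg leaves a cross with `2m - 4` codes, none of one colour. Hence the
recursion `totalCost`, with `blackCost` and `whiteCost` the optimal costs of the two crosses.

Once the arms of a cross are told apart, a line remains. A question on a line either fixes the known
colour and can only find one secret, or removes at most two; this gives the quadratic bound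
`IsLine.le_cost`. For crosses, `IsCross.crossSplit` lists the effects of all questions, and
induction over the tree gives `IsCross.le_cost` and `IsCross.le_cost_of_forall_ne`.
`totalCost_le_cost` combines these and shows that opening with fewer than two possible colours is no
better.

All these bounds allow arbitrary questions, while the matching strategies in `achieves_codesOver`
use only colours that are still possible. One value therefore serves all three variants. -/

theorem black_two {C : Type} [DecidableEq C] (s q : Code 2 C) :
    black s q = (if s 0 = q 0 then 1 else 0) + (if s 1 = q 1 then 1 else 0) := by
  rw [black, Finset.card_filter, Fin.sum_univ_two]

variable {C : Type} [Fintype C] [DecidableEq C]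

theorem colourMatches_two (s q : Code 2 C) :
    colourMatches s q =
      if s 0 = q 0 ∧ s 1 = q 1 ∨ s 0 = q 1 ∧ s 1 = q 0 then 2
      else if s 0 = q 0 ∨ s 1 = q 1 ∨ s 0 = q 1 ∨ s 1 = q 0 then 1 else 0 := by
  have hcount (f : Code 2 C) (c : C) : (Finset.univ.filter fun i => f i = c).card =
      (if f 0 = c then 1 else 0) + (if f 1 = c then 1 else 0) := by
    rw [Finset.card_filter, Fin.sum_univ_two]
  have hsub : colourMatches s q = ∑ c ∈ ({s 0, s 1} : Finset C),
      min ((if s 0 = c then 1 else 0) + (if s 1 = c then 1 else 0))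
        ((if q 0 = c then 1 else 0) + (if q 1 = c then 1 else 0)) := by
    unfold colourMatches
    simp only [hcount]
    symm
    refine Finset.sum_subset (Finset.subset_univ _) fun c _ hc => ?_
    simp only [Finset.mem_insert, Finset.mem_singleton, not_or] at hc
    simp [Ne.symm hc.1, Ne.symm hc.2]
  rw [hsub]
  generalize s 0 = s₀, s 1 = s₁, q 0 = q₀, q 1 = q₁
  by_cases h : s₀ = s₁
  · subst h
    rw [Finset.pair_eq_singleton, Finset.sum_singleton]
    by_cases h₀ : s₀ = q₀ <;> by_cases h₁ : s₀ = q₁ <;> simp [h₀, h₁, eq_comm] <;> grind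
  · rw [Finset.sum_pair h]
    by_cases h₀ : s₀ = q₀ <;> by_cases h₁ : s₀ = q₁ <;> by_cases h₂ : s₁ = q₀ <;>
      by_cases h₃ : s₁ = q₁ <;> simp_all [eq_comm]

theorem answer_two (s q : Code 2 C) :
    answer s q =
      if s 0 = q 0 ∧ s 1 = q 1 then (2, 0)
      else if s 0 = q 0 ∨ s 1 = q 1 then (1, 0)
      else if s 0 = q 1 ∧ s 1 = q 0 then (0, 2)
      else if s 0 = q 1 ∨ s 1 = q 0 then (0, 1) else (0, 0) := by
  rw [answer, white, colourMatches_two, black_two]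
  split_ifs <;> grind

/-- The secrets in `M` for which the question `q` gets the answer `r`. -/
abbrev answerClass (M : Finset (Code 2 C)) (q : Code 2 C) (r : ℕ × ℕ) : Finset (Code 2 C) :=
  M.filter fun s => answer s q = r

theorem mem_class_found {M : Finset (Code 2 C)} {q s : Code 2 C} :
    s ∈ answerClass M q (2, 0) ↔ s ∈ M ∧ s 0 = q 0 ∧ s 1 = q 1 := by
  rw [Finset.mem_filter, answer_two]; split_ifs <;> simp <;> grind

theorem mem_class_black {M : Finset (Code 2 C)} {q s : Code 2 C} :
    s ∈ answerClass M q (1, 0) ↔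
      s ∈ M ∧ (s 0 = q 0 ∧ s 1 ≠ q 1 ∨ s 0 ≠ q 0 ∧ s 1 = q 1) := by
  rw [Finset.mem_filter, answer_two]; split_ifs <;> simp <;> grind

theorem mem_class_swapped {M : Finset (Code 2 C)} {q s : Code 2 C} :
    s ∈ answerClass M q (0, 2) ↔
      s ∈ M ∧ s 0 ≠ q 0 ∧ s 1 ≠ q 1 ∧ s 0 = q 1 ∧ s 1 = q 0 := by
  rw [Finset.mem_filter, answer_two]; split_ifs <;> simp <;> grind

theorem mem_class_white {M : Finset (Code 2 C)} {q s : Code 2 C} :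
    s ∈ answerClass M q (0, 1) ↔ s ∈ M ∧ s 0 ≠ q 0 ∧ s 1 ≠ q 1 ∧
      (s 0 = q 1 ∧ s 1 ≠ q 0 ∨ s 0 ≠ q 1 ∧ s 1 = q 0) := by
  rw [Finset.mem_filter, answer_two]; split_ifs <;> simp <;> grind

theorem mem_class_none {M : Finset (Code 2 C)} {q s : Code 2 C} :
    s ∈ answerClass M q (0, 0) ↔
      s ∈ M ∧ s 0 ≠ q 0 ∧ s 1 ≠ q 1 ∧ s 0 ≠ q 1 ∧ s 1 ≠ q 0 := by
  rw [Finset.mem_filter, answer_two]; split_ifs <;> simp <;> grind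

/-- Only five answers exist: one black and one white peg together are impossible, since the
remaining peg would then be black too. -/
theorem sum_eq_sum_answerClass {N : Type*} [AddCommMonoid N] (M : Finset (Code 2 C))
    (q : Code 2 C) (f : Code 2 C → N) :
    ∑ s ∈ M, f s = ∑ s ∈ answerClass M q (2, 0), f s + ∑ s ∈ answerClass M q (0, 2), f s +
      ∑ s ∈ answerClass M q (1, 0), f s + ∑ s ∈ answerClass M q (0, 1), f s +
      ∑ s ∈ answerClass M q (0, 0), f s := by
  have h : ∀ s ∈ M, answer s q ∈ ({(2, 0), (0, 2), (1, 0), (0, 1), (0, 0)} : Finset (ℕ × ℕ)) := by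
    intro s _
    rw [answer_two]; split_ifs <;> simp
  rw [← Finset.sum_fiberwise_of_maps_to h]
  simp [add_assoc]

theorem card_eq_card_answerClass (M : Finset (Code 2 C)) (q : Code 2 C) :
    M.card = (answerClass M q (2, 0)).card + (answerClass M q (0, 2)).card +
      (answerClass M q (1, 0)).card + (answerClass M q (0, 1)).card +
      (answerClass M q (0, 0)).card := by
  simpa only [Finset.card_eq_sum_ones] using sum_eq_sum_answerClass M q fun _ => 1

/-- Each secret in `M` is found by the tree `t`. -/
def Solves (t : GameTree 2 C) (M : Finset (Code 2 C)) : Prop := ∀ s ∈ M, questionCount t s ≠ ⊤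

/-- The external path length as a natural number. -/
noncomputable def cost (t : GameTree 2 C) (M : Finset (Code 2 C)) : ℕ :=
  ∑ s ∈ M, (questionCount t s).toNat

theorem Solves.mono {t : GameTree 2 C} {M M' : Finset (Code 2 C)} (h : Solves t M)
    (hM : M' ⊆ M) : Solves t M' := fun s hs => h s (hM hs)

theorem externalPathLength_eq_coe {t : GameTree 2 C} {M : Finset (Code 2 C)} (h : Solves t M) :
    externalPathLength t M = (cost t M : ℕ∞) := by
  rw [externalPathLength, cost, Nat.cast_sum]
  exact Finset.sum_congr rfl fun s hs => (ENat.natCast_toNat (h s hs)).symm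

theorem solves_of_externalPathLength_ne_top {t : GameTree 2 C} {M : Finset (Code 2 C)}
    (h : externalPathLength t M ≠ ⊤) : Solves t M := by
  intro s hs hs'
  refine h (top_le_iff.1 ?_)
  rw [← hs']
  exact Finset.single_le_sum (f := fun s => questionCount t s) (fun _ _ => zero_le) hs

theorem Solves.eq_empty_of_halt {M : Finset (Code 2 C)} (h : Solves GameTree.halt M) : M = ∅ :=
  Finset.eq_empty_of_forall_notMem fun s hs => h s hs rfl

theorem Solves.next {q : Code 2 C} {next : ℕ × ℕ → GameTree 2 C} {M : Finset (Code 2 C)}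
    (h : Solves (.ask q next) M) {r : ℕ × ℕ} (hr : r ≠ (2, 0)) :
    Solves (next r) (answerClass M q r) := by
  intro s hs hs'
  obtain ⟨hM, ha⟩ := Finset.mem_filter.1 hs
  refine h s hM ?_
  rw [questionCount, if_neg (ha ▸ hr), ha, hs']
  rfl

theorem Solves.cost_ask {q : Code 2 C} {next : ℕ × ℕ → GameTree 2 C} {M : Finset (Code 2 C)}
    (h : Solves (.ask q next) M) :
    cost (.ask q next) M = M.card + cost (next (0, 2)) (answerClass M q (0, 2)) +
      cost (next (1, 0)) (answerClass M q (1, 0)) + cost (next (0, 1)) (answerClass M q (0, 1)) +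
      cost (next (0, 0)) (answerClass M q (0, 0)) := by
  have hfound : ∑ s ∈ answerClass M q (2, 0), (questionCount (.ask q next) s).toNat =
      (answerClass M q (2, 0)).card := by
    rw [Finset.card_eq_sum_ones]
    refine Finset.sum_congr rfl fun s hs => ?_
    rw [questionCount, if_pos (Finset.mem_filter.1 hs).2]
    rfl
  have hnext (r : ℕ × ℕ) (hr : r ≠ (2, 0)) :
      ∑ s ∈ answerClass M q r, (questionCount (.ask q next) s).toNat =
        (answerClass M q r).card + cost (next r) (answerClass M q r) := by
    rw [cost, Finset.card_eq_sum_ones, ← Finset.sum_add_distrib]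
    refine Finset.sum_congr rfl fun s hs => ?_
    have ha := (Finset.mem_filter.1 hs).2
    have hs' := h.next hr s hs
    -- Finiteness matters: `toNat` sends `⊤` to `0`, so `cost` is meaningful only together with
    -- `Solves`.
    rw [questionCount, if_neg (ha ▸ hr), ha, ENat.toNat_add (by simp) hs']
    rfl
  rw [cost, sum_eq_sum_answerClass M q, hfound, hnext _ (by simp), hnext _ (by simp),
    hnext _ (by simp), hnext _ (by simp), card_eq_card_answerClass M q]
  ring

end TwoPegs

/-! ### Lower bounds for lines and crosses. -/

section LowerBounds

theorem line_find_arith {n₀ n₂ L₂ : ℕ} (h₀ : n₀ ≤ 1) (l : 2 * n₂ ≤ L₂ + 1)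
    (b : n₂ ^ 2 + 6 * n₂ ≤ 4 * L₂ + 4) :
    (n₀ + n₂) ^ 2 + 6 * (n₀ + n₂) ≤ 4 * (n₀ + n₂ + L₂) + 4 := by
  interval_cases n₀
  · nlinarith
  · rcases n₂ with _ | _ | n₂
    · omega
    · omega
    · nlinarith

/-- This is the optimal move on a line: `f r = (r ^ 2 + 6 * r - 4) / 4` satisfies `f r = r + 2 + f
(r - 2)`, so nothing is lost when both singletons are present. -/
theorem line_shrink_arith {e e' n L : ℕ} (he : e ≤ 1) (he' : e' ≤ 1)
    (b : n ^ 2 + 6 * n ≤ 4 * L + 4) :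
    (e + e' + n) ^ 2 + 6 * (e + e' + n) ≤ 4 * (e + e' + n + e + e' + L) + 4 := by
  interval_cases e <;> interval_cases e' <;> nlinarith

/-- The constant 28 is attained when one code is found, one is isolated and the others form two
lines of equal size `r = s`, each of cost `(r ^ 2 + 6 * r - 4) / 4`. -/
theorem cross_find_arith {n₀ n₃ r s K L : ℕ} (h₀ : n₀ ≤ 1) (h₃ : n₃ ≤ 1)
    (hr : r ^ 2 + 6 * r ≤ 4 * K + 4) (hs : s ^ 2 + 6 * s ≤ 4 * L + 4) :
    (n₀ + n₃ + r + s) ^ 2 + 16 * (n₀ + n₃ + r + s) ≤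
      8 * (n₀ + n₃ + r + s + n₃ + K + L) + 28 := by
  have := two_mul_le_add_sq r s
  interval_cases n₀ <;> interval_cases n₃ <;> nlinarith

/-- Splitting off two pairs, of cost at least 3 each, reproduces the quadratic exactly: it grows by
`N + 6` from `N - 4` to `N` codes. -/
theorem cross_shrink_arith {p p' n P P' L : ℕ} (hp : p ≤ 2) (hp' : p' ≤ 2)
    (kp : 2 * p ≤ P + 1) (kp' : 2 * p' ≤ P' + 1) (hn : 3 < p + p' + n)
    (b : n ^ 2 + 16 * n ≤ 8 * L + 28) :
    (p + p' + n) ^ 2 + 16 * (p + p' + n) ≤ 8 * (p + p' + n + P + P' + L) + 28 := by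
  interval_cases p <;> interval_cases p' <;> nlinarith

/-- By `cross_find_arith`, eight times the cost is at least `N ^ 2 + 16 * N - 28`. This reaches `N ^
2 + 14 * N - 16` from `N = 6` on and `N ^ 2 + 14 * N - 15` from `N = 7` on, whence the two
thresholds. -/
theorem special_cross_find_arith {n₀ n₃ r s K L : ℕ} (h₀ : n₀ ≤ 1) (h₃ : n₃ ≤ 1)
    (hr : r ^ 2 + 6 * r ≤ 4 * K + 4) (hs : s ^ 2 + 6 * s ≤ 4 * L + 4) :
    (6 ≤ n₀ + n₃ + r + s → (n₀ + n₃ + r + s) ^ 2 + 14 * (n₀ + n₃ + r + s) ≤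
      8 * (n₀ + n₃ + r + s + n₃ + K + L) + 16) ∧
    (7 ≤ n₀ + n₃ + r + s → (n₀ + n₃ + r + s) ^ 2 + 14 * (n₀ + n₃ + r + s) ≤
      8 * (n₀ + n₃ + r + s + n₃ + K + L) + 15) := by
  have := two_mul_le_add_sq r s
  refine ⟨fun h => ?_, fun h => ?_⟩ <;> interval_cases n₀ <;> interval_cases n₃ <;> nlinarith

theorem special_cross_separate_arith {p e r s P K L : ℕ} (hp : p ≤ 2) (he : e ≤ 1)
    (kp : 2 * p ≤ P + 1)
    (hr : r ^ 2 + 6 * r ≤ 4 * K + 4) (hs : s ^ 2 + 6 * s ≤ 4 * L + 4) (h : 6 ≤ p + e + r + s) :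
    (p + e + r + s) ^ 2 + 14 * (p + e + r + s) ≤
      8 * (p + e + r + s + P + e + K + L) + 15 := by
  have := two_mul_le_add_sq r s
  interval_cases p <;> interval_cases e <;> nlinarith

theorem special_cross_shrink_arith {p p' n P P' L : ℕ} (hp : p ≤ 2) (hp' : p' ≤ 2)
    (kp : 2 * p ≤ P + 1) (kp' : 2 * p' ≤ P' + 1) (kn : 2 * n ≤ L + 1)
    (b₆ : 6 ≤ n → n ^ 2 + 14 * n ≤ 8 * L + 16) (b₇ : 7 ≤ n → n ^ 2 + 14 * n ≤ 8 * L + 15) :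
    (6 ≤ p + p' + n → (p + p' + n) ^ 2 + 14 * (p + p' + n) ≤
      8 * (p + p' + n + P + P' + L) + 16) ∧
    (7 ≤ p + p' + n → (p + p' + n) ^ 2 + 14 * (p + p' + n) ≤
      8 * (p + p' + n + P + P' + L) + 15) := by
  obtain hn | hn := le_or_gt 7 n
  · have b := b₇ hn
    constructor <;> intro _ <;> interval_cases p <;> interval_cases p' <;> nlinarith
  · clear b₇
    constructor <;> intro _ <;> interval_cases n <;> interval_cases p <;> interval_cases p' <;>
      omega

theorem card_le_one_of_forall_eq {C : Type} {M : Finset (Code 2 C)} {x y : C}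
    (h : ∀ s ∈ M, s 0 = x ∧ s 1 = y) : M.card ≤ 1 := by
  refine Finset.card_le_one.2 fun s hs s' hs' => ?_
  funext i
  fin_cases i
  · exact (h s hs).1.trans (h s' hs').1.symm
  · exact (h s hs).2.trans (h s' hs').2.symm

theorem card_le_two_of_forall_eq_or_eq {C : Type} [DecidableEq C] {M : Finset (Code 2 C)} {x y x' y' : C}
    (h : ∀ s ∈ M, s 0 = x ∧ s 1 = y ∨ s 0 = x' ∧ s 1 = y') : M.card ≤ 2 := by
  have hM : M ⊆ {![x, y], ![x', y']} := by
    intro s hs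
    rw [Finset.mem_insert, Finset.mem_singleton]
    refine (h s hs).imp (fun h => ?_) fun h => ?_ <;>
    · funext i
      fin_cases i
      · exact h.1
      · exact h.2
  exact (Finset.card_le_card hM).trans Finset.card_le_two

theorem card_eq_zero_of_forall_false {C : Type} {M : Finset (Code 2 C)} (h : ∀ s ∈ M, False) :
    M.card = 0 :=
  Finset.card_eq_zero.2 (Finset.eq_empty_of_forall_notMem h)

variable {C : Type} [Fintype C] [DecidableEq C]

theorem card_class_found_le_one (M : Finset (Code 2 C)) (q : Code 2 C) :
    (answerClass M q (2, 0)).card ≤ 1 :=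
  card_le_one_of_forall_eq fun _ hs => (mem_class_found.1 hs).2

theorem card_le_cost {t : GameTree 2 C} {M : Finset (Code 2 C)} (h : Solves t M) :
    M.card ≤ cost t M := by
  cases t with
  | halt => simp [h.eq_empty_of_halt]
  | ask q next => rw [h.cost_ask]; omega

theorem two_mul_card_le_cost {t : GameTree 2 C} {M : Finset (Code 2 C)} (h : Solves t M) :
    2 * M.card ≤ cost t M + 1 := by
  cases t with
  | halt => simp [h.eq_empty_of_halt]
  | ask q next =>
    have h1 := card_le_cost (h.next (r := (0, 2)) (by simp))
    have h2 := card_le_cost (h.next (r := (1, 0)) (by simp))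
    have h3 := card_le_cost (h.next (r := (0, 1)) (by simp))
    have h4 := card_le_cost (h.next (r := (0, 0)) (by simp))
    have h5 := card_class_found_le_one M q
    have h6 := card_eq_card_answerClass M q
    rw [h.cost_ask]
    omega

/-- The secrets in `M` share the colour of one peg. -/
def IsLine {C : Type} (M : Finset (Code 2 C)) : Prop := ∃ (i : Fin 2) (a : C), ∀ s ∈ M, s i = a

theorem IsLine.mono {C : Type} {M M' : Finset (Code 2 C)} (h : IsLine M) (hM : M' ⊆ M) :
    IsLine M' :=
  let ⟨i, a, ha⟩ := h
  ⟨i, a, fun s hs => ha s (hM hs)⟩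

/-- If the question has the common colour on its peg, every answer contains a black peg. Otherwise
no code can be found, and the largest class is `(0, 1)` or `(0, 0)` according to whether the common
colour is asked on the other peg. -/
theorem IsLine.card_answerClass {M : Finset (Code 2 C)} (h : IsLine M) (q : Code 2 C) :
    (answerClass M q (0, 2)).card = 0 ∧ (answerClass M q (0, 1)).card = 0 ∧
        (answerClass M q (0, 0)).card = 0 ∨
      (answerClass M q (2, 0)).card = 0 ∧ (answerClass M q (1, 0)).card ≤ 1 ∧
        ((answerClass M q (0, 2)).card ≤ 1 ∧ (answerClass M q (0, 0)).card = 0 ∨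
          (answerClass M q (0, 2)).card = 0 ∧ (answerClass M q (0, 1)).card ≤ 1) := by
  obtain ⟨i, a, hM⟩ := h
  obtain rfl | rfl : i = 0 ∨ i = 1 := by fin_cases i <;> simp
  · by_cases h0 : q 0 = a
    · refine Or.inl ⟨?_, ?_, ?_⟩ <;> refine card_eq_zero_of_forall_false fun s hs => ?_
      · rw [mem_class_swapped] at hs; grind
      · rw [mem_class_white] at hs; grind
      · rw [mem_class_none] at hs; grind
    · refine Or.inr ⟨?_, ?_, ?_⟩
      · refine card_eq_zero_of_forall_false fun s hs => ?_
        rw [mem_class_found] at hs; grind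
      · refine card_le_one_of_forall_eq (x := a) (y := q 1) fun s hs => ?_
        rw [mem_class_black] at hs; grind
      by_cases h1 : q 1 = a
      · refine Or.inl ⟨?_, ?_⟩
        · refine card_le_one_of_forall_eq (x := a) (y := q 0) fun s hs => ?_
          rw [mem_class_swapped] at hs; grind
        · refine card_eq_zero_of_forall_false fun s hs => ?_
          rw [mem_class_none] at hs; grind
      · refine Or.inr ⟨?_, ?_⟩
        · refine card_eq_zero_of_forall_false fun s hs => ?_
          rw [mem_class_swapped] at hs; grind
        · refine card_le_one_of_forall_eq (x := a) (y := q 0) fun s hs => ?_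
          rw [mem_class_white] at hs; grind
  · by_cases h0 : q 1 = a
    · refine Or.inl ⟨?_, ?_, ?_⟩ <;> refine card_eq_zero_of_forall_false fun s hs => ?_
      · rw [mem_class_swapped] at hs; grind
      · rw [mem_class_white] at hs; grind
      · rw [mem_class_none] at hs; grind
    · refine Or.inr ⟨?_, ?_, ?_⟩
      · refine card_eq_zero_of_forall_false fun s hs => ?_
        rw [mem_class_found] at hs; grind
      · refine card_le_one_of_forall_eq (x := q 0) (y := a) fun s hs => ?_
        rw [mem_class_black] at hs; grind
      by_cases h1 : q 0 = a
      · refine Or.inl ⟨?_, ?_⟩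
        · refine card_le_one_of_forall_eq (x := q 1) (y := a) fun s hs => ?_
          rw [mem_class_swapped] at hs; grind
        · refine card_eq_zero_of_forall_false fun s hs => ?_
          rw [mem_class_none] at hs; grind
      · refine Or.inr ⟨?_, ?_⟩
        · refine card_eq_zero_of_forall_false fun s hs => ?_
          rw [mem_class_swapped] at hs; grind
        · refine card_le_one_of_forall_eq (x := q 1) (y := a) fun s hs => ?_
          rw [mem_class_white] at hs; grind

/-- Lower bound for sets of secrets that share the colour of one peg. -/
theorem IsLine.le_cost {t : GameTree 2 C} {M : Finset (Code 2 C)} (hM : IsLine M)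
    (h : Solves t M) : M.card ^ 2 + 6 * M.card ≤ 4 * cost t M + 4 := by
  induction t generalizing M with
  | halt => simp [h.eq_empty_of_halt]
  | ask q next ih =>
    have b (r : ℕ × ℕ) (hr : r ≠ (2, 0)) : (answerClass M q r).card ^ 2 +
        6 * (answerClass M q r).card ≤ 4 * cost (next r) (answerClass M q r) + 4 :=
      ih r (hM.mono (Finset.filter_subset _ M)) (h.next hr)
    have k1 := card_le_cost (h.next (r := (0, 2)) (by simp))
    have k2 := card_le_cost (h.next (r := (1, 0)) (by simp))
    have k3 := card_le_cost (h.next (r := (0, 1)) (by simp))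
    have hc := card_eq_card_answerClass M q
    rw [h.cost_ask]
    obtain ⟨h1, h3, h4⟩ | ⟨h0, h2, ⟨h1, h4⟩ | ⟨h1, h3⟩⟩ := hM.card_answerClass q
    · have := line_find_arith (card_class_found_le_one M q)
        (two_mul_card_le_cost (h.next (r := (1, 0)) (by simp))) (b (1, 0) (by simp))
      rw [h1, h3, h4] at hc
      simp only [add_zero] at hc
      rw [← hc] at this
      omega
    · have := line_shrink_arith h1 h2 (b (0, 1) (by simp))
      rw [h0, h4] at hc
      simp only [add_zero, zero_add] at hc
      rw [← hc] at this
      omega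
    · have := line_shrink_arith h2 h3 (b (0, 0) (by simp))
      rw [h0, h1] at hc
      simp only [zero_add] at hc
      rw [← hc] at this
      omega

/-- All secrets in `M` have the colour `a` on the first or `b` on the second peg, but not both. -/
structure IsCross {C : Type} (a b : C) (M : Finset (Code 2 C)) : Prop where
  ne : a ≠ b
  mem : ∀ s ∈ M, s 0 = a ∧ s 1 ≠ b ∨ s 0 ≠ a ∧ s 1 = b

theorem IsCross.mono {C : Type} {a b : C} {M M' : Finset (Code 2 C)} (h : IsCross a b M)
    (hM : M' ⊆ M) : IsCross a b M' :=
  ⟨h.ne, fun s hs => h.mem s (hM hs)⟩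

/-- The possible effects of a question on a cross. -/
inductive CrossSplit (M : Finset (Code 2 C)) (q : Code 2 C) : Prop
  | useless (h₀ : (answerClass M q (2, 0)).card = 0) (h₁ : (answerClass M q (0, 2)).card = 0)
      (h₃ : (answerClass M q (0, 1)).card = 0) (h₄ : (answerClass M q (0, 0)).card = 0)
  | find (h₁ : (answerClass M q (0, 2)).card = 0) (h₃ : (answerClass M q (0, 1)).card ≤ 1)
      (h₂ : IsLine (answerClass M q (1, 0))) (h₄ : IsLine (answerClass M q (0, 0)))
  | shrink (h₀ : (answerClass M q (2, 0)).card = 0) (h₁ : (answerClass M q (0, 2)).card = 0)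
      (h₂ : (answerClass M q (1, 0)).card ≤ 2) (h₃ : (answerClass M q (0, 1)).card ≤ 2)
  | separate (h₀ : (answerClass M q (2, 0)).card = 0) (h₁ : (answerClass M q (0, 2)).card ≤ 1)
      (h₂ : (answerClass M q (1, 0)).card ≤ 2)
      (h₂' : (∀ s ∈ M, s 0 ≠ s 1) → (answerClass M q (1, 0)).card ≤ 1)
      (h₃ : IsLine (answerClass M q (0, 1))) (h₄ : IsLine (answerClass M q (0, 0)))
  | diagonal (h₀ : (answerClass M q (2, 0)).card = 0) (h₁ : (answerClass M q (0, 2)).card = 0)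
      (h₄ : (answerClass M q (0, 0)).card = 0) (h₂ : (answerClass M q (1, 0)).card ≤ 2)

/-- Only the positions of `a` and `b` in the question matter. On its own peg such a colour answers
black for its whole arm, on the other peg it gives at least a colour match for that arm; if neither
occurs, at most two codes on each arm are affected. -/
theorem IsCross.crossSplit {a b : C} {M : Finset (Code 2 C)} (h : IsCross a b M)
    (q : Code 2 C) : CrossSplit M q := by
  obtain ⟨hab, hM⟩ := h
  by_cases ha : q 0 = a
  · by_cases hb : q 1 = b
    · refine .useless ?_ ?_ ?_ ?_ <;> refine card_eq_zero_of_forall_false fun s hs => ?_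
      · rw [mem_class_found] at hs; grind
      · rw [mem_class_swapped] at hs; grind
      · rw [mem_class_white] at hs; grind
      · rw [mem_class_none] at hs; grind
    · refine .find ?_ ?_ ⟨0, a, fun s hs => ?_⟩ ⟨1, b, fun s hs => ?_⟩
      · refine card_eq_zero_of_forall_false fun s hs => ?_
        rw [mem_class_swapped] at hs; grind
      · refine card_le_one_of_forall_eq (x := q 1) (y := b) fun s hs => ?_
        rw [mem_class_white] at hs; grind
      · rw [mem_class_black] at hs; grind
      · rw [mem_class_none] at hs; grind
  by_cases hb : q 1 = b
  · refine .find ?_ ?_ ⟨1, b, fun s hs => ?_⟩ ⟨0, a, fun s hs => ?_⟩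
    · refine card_eq_zero_of_forall_false fun s hs => ?_
      rw [mem_class_swapped] at hs; grind
    · refine card_le_one_of_forall_eq (x := a) (y := q 0) fun s hs => ?_
      rw [mem_class_white] at hs; grind
    · rw [mem_class_black] at hs; grind
    · rw [mem_class_none] at hs; grind
  have h₀ : (answerClass M q (2, 0)).card = 0 := by
    refine card_eq_zero_of_forall_false fun s hs => ?_
    rw [mem_class_found] at hs; grind
  have h₂ : (answerClass M q (1, 0)).card ≤ 2 := by
    refine card_le_two_of_forall_eq_or_eq (x := a) (y := q 1) (x' := q 0) (y' := b)
      fun s hs => ?_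
    rw [mem_class_black] at hs; grind
  by_cases ha' : q 1 = a
  · by_cases hb' : q 0 = b
    · refine .diagonal h₀ ?_ ?_ h₂ <;> refine card_eq_zero_of_forall_false fun s hs => ?_
      · rw [mem_class_swapped] at hs; grind
      · rw [mem_class_none] at hs; grind
    · refine .separate h₀ ?_ h₂ (fun hd => ?_) ⟨0, a, fun s hs => ?_⟩ ⟨1, b, fun s hs => ?_⟩
      · refine card_le_one_of_forall_eq (x := a) (y := q 0) fun s hs => ?_
        rw [mem_class_swapped] at hs; grind
      · refine card_le_one_of_forall_eq (x := q 0) (y := b) fun s hs => ?_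
        rw [mem_class_black] at hs; grind
      · rw [mem_class_white] at hs; grind
      · rw [mem_class_none] at hs; grind
  · by_cases hb' : q 0 = b
    · refine .separate h₀ ?_ h₂ (fun hd => ?_) ⟨1, b, fun s hs => ?_⟩ ⟨0, a, fun s hs => ?_⟩
      · refine card_le_one_of_forall_eq (x := q 1) (y := b) fun s hs => ?_
        rw [mem_class_swapped] at hs; grind
      · refine card_le_one_of_forall_eq (x := a) (y := q 1) fun s hs => ?_
        rw [mem_class_black] at hs; grind
      · rw [mem_class_white] at hs; grind
      · rw [mem_class_none] at hs; grind
    · refine .shrink h₀ ?_ h₂ ?_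
      · refine card_eq_zero_of_forall_false fun s hs => ?_
        rw [mem_class_swapped] at hs; grind
      · refine card_le_two_of_forall_eq_or_eq (x := a) (y := q 0) (x' := q 1) (y' := b)
          fun s hs => ?_
        rw [mem_class_white] at hs; grind

/-- Lower bound for crosses without codes of one colour. -/
theorem IsCross.le_cost_of_forall_ne {a b : C} {t : GameTree 2 C} {M : Finset (Code 2 C)}
    (hM : IsCross a b M) (hd : ∀ s ∈ M, s 0 ≠ s 1) (h : Solves t M) :
    M.card ^ 2 + 16 * M.card ≤ 8 * cost t M + 28 := by
  induction t generalizing M with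
  | halt => simp [h.eq_empty_of_halt]
  | ask q next ih =>
    have b (r : ℕ × ℕ) (hr : r ≠ (2, 0)) : (answerClass M q r).card ^ 2 +
        16 * (answerClass M q r).card ≤ 8 * cost (next r) (answerClass M q r) + 28 :=
      ih r (hM.mono (Finset.filter_subset _ M)) (fun s hs => hd s (Finset.mem_filter.1 hs).1)
        (h.next hr)
    have k (r : ℕ × ℕ) (hr : r ≠ (2, 0)) := two_mul_card_le_cost (h.next hr)
    have line {r : ℕ × ℕ} (hl : IsLine (answerClass M q r)) (hr : r ≠ (2, 0)) :=
      hl.le_cost (h.next hr)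
    have k1 := k (0, 2) (by simp)
    have k2 := k (1, 0) (by simp)
    have k3 := k (0, 1) (by simp)
    have hc := card_eq_card_answerClass M q
    have hl := two_mul_card_le_cost h
    obtain hN | hN := le_or_gt M.card 3
    · interval_cases M.card <;> omega
    rw [h.cost_ask]
    cases hM.crossSplit q with
    | useless h₀ h₁ h₃ h₄ =>
      have := b (1, 0) (by simp)
      rw [h₀, h₁, h₃, h₄] at hc
      simp only [add_zero, zero_add] at hc
      rw [← hc] at this
      omega
    | find h₁ h₃ h₂ h₄ =>
      have := cross_find_arith (card_class_found_le_one M q) h₃ (line h₂ (by simp))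
        (line h₄ (by simp))
      rw [show _ + _ + _ + _ = M.card by omega] at this
      omega
    | shrink h₀ h₁ h₂ h₃ =>
      have := cross_shrink_arith h₂ h₃ k2 k3 (by omega) (b (0, 0) (by simp))
      rw [show _ + _ + _ = M.card by omega] at this
      omega
    | separate h₀ h₁ h₂ h₂' h₃ h₄ =>
      -- Without codes of one colour, separating is no better than finding: the swapped code takes
      -- the place of the found one, and its extra question is discarded.
      have := cross_find_arith h₁ (h₂' hd) (line h₃ (by simp)) (line h₄ (by simp))
      rw [show _ + _ + _ + _ = M.card by omega] at this
      omega
    | diagonal h₀ h₁ h₄ h₂ =>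
      -- A shrink with an empty second pair, in which the remaining cross is the class `(0, 1)`.
      have := cross_shrink_arith h₂ zero_le_two k2 (P' := 0) (by simp) (by omega)
        (b (0, 1) (by simp))
      rw [show _ + _ + _ = M.card by omega] at this
      omega

/-- Lower bound for arbitrary crosses. -/
theorem IsCross.le_cost {a b : C} {t : GameTree 2 C} {M : Finset (Code 2 C)}
    (hM : IsCross a b M) (h : Solves t M) :
    (6 ≤ M.card → M.card ^ 2 + 14 * M.card ≤ 8 * cost t M + 16) ∧
      (7 ≤ M.card → M.card ^ 2 + 14 * M.card ≤ 8 * cost t M + 15) := by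
  induction t generalizing M with
  | halt => simp [h.eq_empty_of_halt]
  | ask q next ih =>
    have b (r : ℕ × ℕ) (hr : r ≠ (2, 0)) :
        (6 ≤ (answerClass M q r).card → (answerClass M q r).card ^ 2 +
          14 * (answerClass M q r).card ≤ 8 * cost (next r) (answerClass M q r) + 16) ∧
        (7 ≤ (answerClass M q r).card → (answerClass M q r).card ^ 2 +
          14 * (answerClass M q r).card ≤ 8 * cost (next r) (answerClass M q r) + 15) :=
      ih r (hM.mono (Finset.filter_subset _ M)) (h.next hr)
    have k (r : ℕ × ℕ) (hr : r ≠ (2, 0)) := two_mul_card_le_cost (h.next hr)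
    have line {r : ℕ × ℕ} (hl : IsLine (answerClass M q r)) (hr : r ≠ (2, 0)) :=
      hl.le_cost (h.next hr)
    have k1 := k (0, 2) (by simp)
    have k2 := k (1, 0) (by simp)
    have k3 := k (0, 1) (by simp)
    have hc := card_eq_card_answerClass M q
    rw [h.cost_ask]
    cases hM.crossSplit q with
    | useless h₀ h₁ h₃ h₄ =>
      have := b (1, 0) (by simp)
      rw [h₀, h₁, h₃, h₄] at hc
      simp only [add_zero, zero_add] at hc
      rw [← hc] at this
      omega
    | find h₁ h₃ h₂ h₄ =>
      have := special_cross_find_arith (card_class_found_le_one M q) h₃ (line h₂ (by simp))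
        (line h₄ (by simp))
      rw [show _ + _ + _ + _ = M.card by omega] at this
      omega
    | shrink h₀ h₁ h₂ h₃ =>
      have := special_cross_shrink_arith h₂ h₃ k2 k3 (k (0, 0) (by simp)) (b (0, 0) (by simp)).1
        (b (0, 0) (by simp)).2
      rw [show _ + _ + _ = M.card by omega] at this
      omega
    | separate h₀ h₁ h₂ h₂' h₃ h₄ =>
      have := special_cross_separate_arith h₂ h₁ k2 (line h₃ (by simp)) (line h₄ (by simp))
      rw [show _ + _ + _ + _ = M.card by omega] at this
      omega
    | diagonal h₀ h₁ h₄ h₂ =>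
      have := special_cross_shrink_arith h₂ zero_le_two k2 (P' := 0) (by simp) k3
        (b (0, 1) (by simp)).1 (b (0, 1) (by simp)).2
      rw [show _ + _ + _ = M.card by omega] at this
      omega

end LowerBounds

/-! ### The recursion for the optimal cost and its closed form. -/

section Values

/-- The minimal external path length of a line with `r` elements. -/
def lineCost (r : ℕ) : ℕ := (r ^ 2 + 6 * r - 3) / 4

/-- The minimal external path length after one black peg for a first question with two of
`m` colours. -/
def blackCost (m : ℕ) : ℕ := if m = 3 ∨ m = 4 then 6 * m - 11 else (m ^ 2 + 5 * m - 8) / 2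

/-- The minimal external path length after one white peg for a first question with two of
`k + 2` colours. -/
def whiteCost : ℕ → ℕ
  | 0 => 0
  | k + 1 => 2 * k + 3 + 2 * lineCost k

/-- The minimal external path length of the game with `m` colours. -/
def totalCost : ℕ → ℕ
  | 0 => 0
  | 1 => 1
  | m + 2 => (m + 2) ^ 2 + 1 + blackCost (m + 2) + whiteCost m + totalCost m

theorem lineCost_mono : Monotone lineCost := fun r s h =>
  Nat.div_le_div_right (Nat.sub_le_sub_right (by gcongr) 3)

theorem four_mul_lineCost_le (r : ℕ) : 4 * lineCost (r + 1) + 3 ≤ (r + 1) ^ 2 + 6 * (r + 1) := by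
  have h := Nat.mul_div_le ((r + 1) ^ 2 + 6 * (r + 1) - 3) 4
  rw [lineCost]
  omega

theorem lineCost_even (j : ℕ) : lineCost (2 * j + 2) = j ^ 2 + 5 * j + 3 := by
  rw [lineCost, show (2 * j + 2) ^ 2 + 6 * (2 * j + 2) = 4 * (j ^ 2 + 5 * j + 3) + 4 by ring]
  omega

theorem lineCost_odd (j : ℕ) : lineCost (2 * j + 1) = j ^ 2 + 4 * j + 1 := by
  rw [lineCost, show (2 * j + 1) ^ 2 + 6 * (2 * j + 1) = 4 * (j ^ 2 + 4 * j + 1) + 3 by ring]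
  omega

theorem lineCost_add_two (r : ℕ) : lineCost (r + 3) = r + 5 + lineCost (r + 1) := by
  rw [lineCost, lineCost, show (r + 3) ^ 2 + 6 * (r + 3) = r ^ 2 + 12 * r + 27 by ring,
    show (r + 1) ^ 2 + 6 * (r + 1) = r ^ 2 + 8 * r + 7 by ring]
  omega

theorem two_mul_blackCost (m : ℕ) : 2 * blackCost (m + 5) = m ^ 2 + 15 * m + 42 := by
  have h2 : 2 ∣ m ^ 2 + 15 * m := by
    rw [show m ^ 2 + 15 * m = m * (m + 1) + 2 * (7 * m) by ring]
    exact dvd_add (Nat.even_mul_succ_self m).two_dvd (dvd_mul_right _ _)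
  rw [blackCost, if_neg (by omega),
    show (m + 5) ^ 2 + 5 * (m + 5) = m ^ 2 + 15 * m + 50 by ring]
  omega

/-- The recursion has step two, so the parities are separate inductions. The exceptional values of
`blackCost` at 3 and 4 enter only through the base cases. -/
theorem totalCost_odd (k : ℕ) :
    24 * totalCost (2 * k + 3) + 80 * (2 * k + 3) =
      8 * (2 * k + 3) ^ 3 + 51 * (2 * k + 3) ^ 2 + 69 := by
  induction k with
  | zero => decide
  | succ k ih =>
    have h := two_mul_blackCost (2 * k)
    rw [show 2 * (k + 1) + 3 = 2 * k + 3 + 2 by ring, totalCost,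
      show whiteCost (2 * k + 3) = 2 * (2 * k + 2) + 3 + 2 * lineCost (2 * k + 2) from rfl,
      lineCost_even, show 2 * k + 3 + 2 = 2 * k + 5 by ring]
    linarith

theorem totalCost_even (k : ℕ) :
    24 * totalCost (2 * k + 4) + 74 * (2 * k + 4) =
      8 * (2 * k + 4) ^ 3 + 51 * (2 * k + 4) ^ 2 + 48 := by
  induction k with
  | zero => decide
  | succ k ih =>
    have h := two_mul_blackCost (2 * k + 1)
    rw [show 2 * (k + 1) + 4 = 2 * k + 4 + 2 by ring, totalCost,
      show whiteCost (2 * k + 4) = 2 * (2 * k + 3) + 3 + 2 * lineCost (2 * (k + 1) + 1) from rfl,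
      lineCost_odd, show 2 * k + 4 + 2 = 2 * k + 1 + 5 by ring]
    linarith

/-- Used to rule out a first question with a single possible colour: it leaves two lines of at least
`m + 2` codes and the game with one colour less. -/
theorem totalCost_succ_le (m : ℕ) :
    2 * totalCost (m + 3) + 4 ≤
      2 * (m + 3) ^ 2 + (m + 2) ^ 2 + 6 * (m + 2) + 2 * totalCost (m + 2) := by
  obtain ⟨k, rfl | rfl⟩ := m.even_or_odd'
  · rcases k with _ | k
    · decide
    · have h₁ := totalCost_odd (k + 1)
      have h₂ := totalCost_even k
      rw [show 2 * (k + 1) + 2 = 2 * k + 4 by ring]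
      nlinarith
  · have h₁ := totalCost_even k
    have h₂ := totalCost_odd k
    rw [show 2 * k + 1 + 3 = 2 * k + 4 by ring, show 2 * k + 1 + 2 = 2 * k + 3 by ring]
    nlinarith

end Values

/-! ### The lower bound for the whole game. -/

section MainLowerBound

theorem mem_codesOver_two {C : Type} {S : Finset C} {s : Code 2 C} :
    s ∈ codesOver 2 S ↔ s 0 ∈ S ∧ s 1 ∈ S := by
  simp [codesOver, Fintype.mem_piFinset, Fin.forall_fin_two]

theorem card_codesOver_two {C : Type} (S : Finset C) : (codesOver 2 S).card = S.card ^ 2 := by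
  simp [codesOver, Fintype.card_piFinset]

theorem card_le_of_forall_eq_of_mem {C : Type} {M : Finset (Code 2 C)} {i j : Fin 2} (hij : i ≠ j) {a : C}
    {S : Finset C} (h : ∀ s ∈ M, s i = a ∧ s j ∈ S) : M.card ≤ S.card := by
  refine Finset.card_le_card_of_injOn (fun s => s j) (fun s hs => (h s hs).2) ?_
  intro s hs s' hs' he
  funext l
  obtain rfl | rfl : l = i ∨ l = j := by omega
  · exact (h s hs).1.trans (h s' hs').1.symm
  · exact he

theorem card_eq_card_filter_add {C : Type} [DecidableEq C] {M : Finset (Code 2 C)} (i : Fin 2) (a : C) :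
    M.card = (M.filter fun s => s i = a).card + (M.filter fun s => s i ≠ a).card :=
  (Finset.card_filter_add_card_filter_not _).symm

variable {C : Type} [Fintype C] [DecidableEq C]

theorem blackCost_le_cost {a b : C} {t : GameTree 2 C} {M : Finset (Code 2 C)} {m : ℕ}
    (hM : IsCross a b M) (hcard : M.card = 2 * m + 2) (h : Solves t M) :
    blackCost (m + 2) ≤ cost t M := by
  obtain ⟨h₆, h₇⟩ := hM.le_cost h
  have h₂ := two_mul_card_le_cost h
  rw [hcard] at h₆ h₇ h₂
  match m with
  -- Two and four codes need only the bound `2 * N - 1`; six codes need the weaker quadratic bound,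
  -- which is sharp there.
  | 0 => exact (show blackCost 2 = 3 from rfl) ▸ (by omega)
  | 1 => exact (show blackCost 3 = 7 from rfl) ▸ (by omega)
  | 2 => exact (show blackCost 4 = 13 from rfl) ▸ (by omega)
  | m + 3 =>
    have := two_mul_blackCost m
    have := h₇ (by omega)
    rw [show m + 3 + 2 = m + 5 by ring]
    nlinarith

theorem whiteCost_le_cost {a b : C} {t : GameTree 2 C} {M : Finset (Code 2 C)} {k : ℕ}
    (hM : IsCross a b M) (hd : ∀ s ∈ M, s 0 ≠ s 1) (hcard : M.card = 2 * k) (h : Solves t M) :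
    whiteCost k ≤ cost t M := by
  have h₈ := hM.le_cost_of_forall_ne hd h
  have h₂ := two_mul_card_le_cost h
  rw [hcard] at h₈ h₂
  match k with
  | 0 => exact Nat.zero_le _
  | 1 => exact (show whiteCost 1 = 3 from rfl) ▸ (by omega)
  | k + 2 =>
    have := four_mul_lineCost_le k
    rw [whiteCost]
    -- The quadratic bound may fall short of `whiteCost` by one half; integrality closes the gap.
    by_contra! hlt
    nlinarith

/-- The classes of a question with two different possible colours. -/
theorem card_answerClass_of_ne {S : Finset C} {q : Code 2 C} {m : ℕ} (h₀ : q 0 ∈ S)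
    (h₁ : q 1 ∈ S) (hq : q 0 ≠ q 1) (hm : S.card = m + 2) :
    answerClass (codesOver 2 S) q (0, 0) = codesOver 2 ((S.erase (q 0)).erase (q 1)) ∧
      ((S.erase (q 0)).erase (q 1)).card = m ∧
      (answerClass (codesOver 2 S) q (0, 2)).card = 1 ∧
      (answerClass (codesOver 2 S) q (1, 0)).card = 2 * m + 2 ∧
      (answerClass (codesOver 2 S) q (0, 1)).card = 2 * m := by
  have hnone : answerClass (codesOver 2 S) q (0, 0) =
      codesOver 2 ((S.erase (q 0)).erase (q 1)) := by
    ext s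
    rw [mem_class_none, mem_codesOver_two, mem_codesOver_two]
    grind
  have c₀ : (S.erase (q 0)).card = m + 1 := by rw [Finset.card_erase_of_mem h₀, hm]; rfl
  have c₁ : (S.erase (q 1)).card = m + 1 := by rw [Finset.card_erase_of_mem h₁, hm]; rfl
  have c₂ : ((S.erase (q 0)).erase (q 1)).card = m := by
    rw [Finset.card_erase_of_mem (Finset.mem_erase.2 ⟨hq.symm, h₁⟩), c₀]; rfl
  have hf := card_class_found_le_one (codesOver 2 S) q
  have hs : (answerClass (codesOver 2 S) q (0, 2)).card ≤ 1 :=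
    card_le_one_of_forall_eq (x := q 1) (y := q 0) fun s hs => (mem_class_swapped.1 hs).2.2.2
  have hb : (answerClass (codesOver 2 S) q (1, 0)).card ≤ (m + 1) + (m + 1) := by
    rw [card_eq_card_filter_add 0 (q 0)]
    refine add_le_add ?_ ?_
    · rw [← c₁]
      refine card_le_of_forall_eq_of_mem (i := 0) (j := 1) (a := q 0) (by simp) fun s hs => ?_
      rw [Finset.mem_filter, mem_class_black, mem_codesOver_two] at hs
      grind
    · rw [← c₀]
      refine card_le_of_forall_eq_of_mem (i := 1) (j := 0) (a := q 1) (by simp) fun s hs => ?_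
      rw [Finset.mem_filter, mem_class_black, mem_codesOver_two] at hs
      grind
  have hw : (answerClass (codesOver 2 S) q (0, 1)).card ≤ m + m := by
    rw [card_eq_card_filter_add 0 (q 1), ← c₂]
    refine add_le_add ?_ ?_
    · refine card_le_of_forall_eq_of_mem (i := 0) (j := 1) (a := q 1) (by simp) fun s hs => ?_
      rw [Finset.mem_filter, mem_class_white, mem_codesOver_two] at hs
      grind
    · refine card_le_of_forall_eq_of_mem (i := 1) (j := 0) (a := q 0) (by simp) fun s hs => ?_
      rw [Finset.mem_filter, mem_class_white, mem_codesOver_two] at hs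
      grind
  -- The upper bounds on the classes add up to `(m + 2) ^ 2`, so each of them is an equality.
  have hc := card_eq_card_answerClass (codesOver 2 S) q
  have hn : (answerClass (codesOver 2 S) q (0, 0)).card = m ^ 2 := by
    rw [hnone, card_codesOver_two, c₂]
  rw [card_codesOver_two, hn, hm, show (m + 2) ^ 2 = m ^ 2 + 4 * m + 4 by ring] at hc
  refine ⟨hnone, c₂, ?_, ?_, ?_⟩ <;> omega

theorem isCross_class_black {S : Finset C} {q : Code 2 C} (hq : q 0 ≠ q 1) :
    IsCross (q 0) (q 1) (answerClass (codesOver 2 S) q (1, 0)) :=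
  ⟨hq, fun s hs => by rw [mem_class_black] at hs; grind⟩

theorem isCross_class_white {S : Finset C} {q : Code 2 C} (hq : q 0 ≠ q 1) :
    IsCross (q 1) (q 0) (answerClass (codesOver 2 S) q (0, 1)) :=
  ⟨hq.symm, fun s hs => by rw [mem_class_white] at hs; grind⟩

theorem cost_filter_add (t : GameTree 2 C) (M : Finset (Code 2 C)) (p : Code 2 C → Prop)
    [DecidablePred p] : cost t M = cost t (M.filter p) + cost t (M.filter fun s => ¬ p s) :=
  (Finset.sum_filter_add_sum_filter_not M p _).symm

/-- The classes of a question with one possible colour. -/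
theorem cost_of_single_colour {S : Finset C} {q : Code 2 C} {next : ℕ × ℕ → GameTree 2 C}
    {k : ℕ} {a : C} (ha : a ∈ S) (hm : S.card = k + 2)
    (hq : q 0 = a ∧ q 1 = a ∨ q 0 = a ∧ q 1 ∉ S ∨ q 0 ∉ S ∧ q 1 = a)
    (h : Solves (.ask q next) (codesOver 2 S)) :
    answerClass (codesOver 2 S) q (0, 0) = codesOver 2 (S.erase a) ∧
      3 ≤ cost (next (1, 0)) (answerClass (codesOver 2 S) q (1, 0)) +
        cost (next (0, 1)) (answerClass (codesOver 2 S) q (0, 1)) ∧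
      (k + 1) ^ 2 + 6 * (k + 1) ≤
        2 * (cost (next (1, 0)) (answerClass (codesOver 2 S) q (1, 0)) +
          cost (next (0, 1)) (answerClass (codesOver 2 S) q (0, 1))) + 4 := by
  have hnone : answerClass (codesOver 2 S) q (0, 0) = codesOver 2 (S.erase a) := by
    ext s
    rw [mem_class_none, mem_codesOver_two, mem_codesOver_two]
    grind
  have ce : (S.erase a).card = k + 1 := by rw [Finset.card_erase_of_mem ha, hm]; rfl
  have hf := card_class_found_le_one (codesOver 2 S) q
  have hs : (answerClass (codesOver 2 S) q (0, 2)).card = 0 := by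
    refine card_eq_zero_of_forall_false fun s hs => ?_
    rw [mem_class_swapped, mem_codesOver_two] at hs
    grind
  have hn : (answerClass (codesOver 2 S) q (0, 0)).card = (k + 1) ^ 2 := by
    rw [hnone, card_codesOver_two, ce]
  have hc := card_eq_card_answerClass (codesOver 2 S) q
  rw [card_codesOver_two, hn, hm, hs,
    show (k + 2) ^ 2 = (k + 1) ^ 2 + (2 * k + 3) by ring] at hc
  have two := two_mul_card_le_cost (h.next (r := (1, 0)) (by simp))
  refine ⟨hnone, ?_⟩
  rcases hq with hq | hq
  · have hw : (answerClass (codesOver 2 S) q (0, 1)).card = 0 := by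
      refine card_eq_zero_of_forall_false fun s hs => ?_
      rw [mem_class_white] at hs
      grind
    -- Both arms lie in the same class, but `cost` is additive over secrets, so the line bound
    -- applies to the same tree on each arm separately.
    have l₁ := h.next (r := (1, 0)) (by simp)
    have b₁ := IsLine.le_cost (M := (answerClass (codesOver 2 S) q (1, 0)).filter fun s : Code 2 C => s 0 = a)
      ⟨0, a, fun s hs => by rw [Finset.mem_filter] at hs; exact hs.2⟩ (l₁.mono (Finset.filter_subset _ _))
    have b₂ := IsLine.le_cost
      (M := (answerClass (codesOver 2 S) q (1, 0)).filter fun s : Code 2 C => ¬ s 0 = a)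
      ⟨1, a, fun s hs => by rw [Finset.mem_filter, mem_class_black] at hs; grind⟩ (l₁.mono (Finset.filter_subset _ _))
    have c₁ : ((answerClass (codesOver 2 S) q (1, 0)).filter fun s : Code 2 C => s 0 = a).card ≤ k + 1 := by
      rw [← ce]
      refine card_le_of_forall_eq_of_mem (i := 0) (j := 1) (a := a) (by simp) fun s hs => ?_
      rw [Finset.mem_filter, mem_class_black, mem_codesOver_two] at hs
      grind
    have c₂ : ((answerClass (codesOver 2 S) q (1, 0)).filter fun s : Code 2 C => ¬ s 0 = a).card ≤
        k + 1 := by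
      rw [← ce]
      refine card_le_of_forall_eq_of_mem (i := 1) (j := 0) (a := a) (by simp) fun s hs => ?_
      rw [Finset.mem_filter, mem_class_black, mem_codesOver_two] at hs
      grind
    have hcard := card_eq_card_filter_add (M := answerClass (codesOver 2 S) q (1, 0)) 0 a
    simp only [ne_eq] at hcard
    rw [le_antisymm c₁ (by omega)] at b₁
    rw [le_antisymm c₂ (by omega)] at b₂
    rw [cost_filter_add _ (answerClass (codesOver 2 S) q (1, 0)) fun s : Code 2 C => s 0 = a] at two ⊢
    omega
  -- With an impossible colour on peg `j`, the two arms are the classes black and white, and the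
  -- black one also keeps the code `(a, a)`.
  · obtain ⟨i, j, hij, hqi, hqj⟩ : ∃ i j : Fin 2, (i = 0 ∧ j = 1 ∨ i = 1 ∧ j = 0) ∧
        q i = a ∧ q j ∉ S := by
      rcases hq with hq | hq
      · exact ⟨0, 1, by simp, hq⟩
      · exact ⟨1, 0, by simp, hq.symm⟩
    have hne : i ≠ j := by omega
    have hf : (answerClass (codesOver 2 S) q (2, 0)).card = 0 := by
      refine card_eq_zero_of_forall_false fun s hs => ?_
      rw [mem_class_found, mem_codesOver_two] at hs
      grind
    have hb : ∀ s ∈ answerClass (codesOver 2 S) q (1, 0), s i = a ∧ s j ∈ S := by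
      intro s hs
      rw [mem_class_black, mem_codesOver_two] at hs
      grind
    have hw : ∀ s ∈ answerClass (codesOver 2 S) q (0, 1), s j = a ∧ s i ∈ S.erase a := by
      intro s hs
      rw [mem_class_white, mem_codesOver_two] at hs
      grind
    have c₁ := card_le_of_forall_eq_of_mem hne hb
    have c₂ := card_le_of_forall_eq_of_mem hne.symm hw
    have b₁ := IsLine.le_cost ⟨i, a, fun s hs => (hb s hs).1⟩ (h.next (r := (1, 0)) (by simp))
    have b₂ := IsLine.le_cost ⟨j, a, fun s hs => (hw s hs).1⟩ (h.next (r := (0, 1)) (by simp))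
    have c₁' : (answerClass (codesOver 2 S) q (1, 0)).card = k + 2 := by omega
    have c₂' : (answerClass (codesOver 2 S) q (0, 1)).card = k + 1 := by omega
    rw [c₁'] at b₁ two
    rw [c₂'] at b₂
    constructor
    · omega
    · nlinarith

/-- Lower bound for the game in which exactly the colours in `S` are possible. -/
theorem totalCost_le_cost {t : GameTree 2 C} {S : Finset C} (h : Solves t (codesOver 2 S)) :
    totalCost S.card ≤ cost t (codesOver 2 S) := by
  induction t generalizing S with
  | halt =>
    have h₀ := card_codesOver_two S
    rw [h.eq_empty_of_halt, Finset.card_empty] at h₀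
    rw [eq_comm, pow_eq_zero_iff two_ne_zero] at h₀
    rw [h₀]
    exact Nat.zero_le _
  | ask q next ih =>
    have hone := card_le_cost h
    rw [card_codesOver_two] at hone
    obtain hm | hm | ⟨k, hm⟩ : S.card = 0 ∨ S.card = 1 ∨ ∃ k, S.card = k + 2 := by
      rcases S.card with _ | _ | k
      · simp
      · simp
      · exact Or.inr (Or.inr ⟨k, rfl⟩)
    · rw [hm]; exact Nat.zero_le _
    · rw [hm] at hone ⊢; exact hone
    have hnext : Solves (next (0, 0)) (answerClass (codesOver 2 S) q (0, 0)) :=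
      h.next (by simp)
    by_cases hq : q 0 ∈ S ∧ q 1 ∈ S ∧ q 0 ≠ q 1
    · obtain ⟨hnone, hm', h₁, h₂, h₃⟩ := card_answerClass_of_ne hq.1 hq.2.1 hq.2.2 hm
      have b₁ := card_le_cost (h.next (r := (0, 2)) (by simp))
      have b₂ := blackCost_le_cost (isCross_class_black hq.2.2) h₂
        (h.next (r := (1, 0)) (by simp))
      have b₃ := whiteCost_le_cost (isCross_class_white hq.2.2)
        (fun s hs => by rw [mem_class_white] at hs; grind) h₃ (h.next (r := (0, 1)) (by simp))
      rw [hnone] at hnext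
      have b₄ := ih (0, 0) hnext
      rw [hm'] at b₄
      rw [h.cost_ask, hnone, card_codesOver_two, hm, totalCost]
      omega
    by_cases hq' : q 0 ∉ S ∧ q 1 ∉ S
    -- Such a question gives no information, so the bound for the subtree suffices.
    · have hnone : answerClass (codesOver 2 S) q (0, 0) = codesOver 2 S := by
        ext s
        rw [mem_class_none, mem_codesOver_two]
        grind
      rw [hnone] at hnext
      have := ih (0, 0) hnext
      rw [h.cost_ask, hnone]
      omega
    obtain ⟨a, ha, hqa⟩ : ∃ a ∈ S,
        q 0 = a ∧ q 1 = a ∨ q 0 = a ∧ q 1 ∉ S ∨ q 0 ∉ S ∧ q 1 = a := by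
      by_cases h₀ : q 0 ∈ S
      · exact ⟨q 0, h₀, by grind⟩
      · exact ⟨q 1, by grind, by grind⟩
    obtain ⟨hnone, h₁, h₂⟩ := cost_of_single_colour ha hm hqa h
    rw [hnone] at hnext
    have b := ih (0, 0) hnext
    rw [Finset.card_erase_of_mem ha, hm, show k + 2 - 1 = k + 1 from rfl] at b
    rw [h.cost_ask, hnone, card_codesOver_two, hm]
    -- Two colours are outside the range of `totalCost_succ_le`; here `4 + 3 + 1 = 8` is exactly
    -- enough.
    rcases k with _ | k
    · have : totalCost (0 + 1) = 1 := rfl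
      have : totalCost (0 + 2) = 8 := rfl
      omega
    · have := totalCost_succ_le k
      rw [show k + 1 + 1 = k + 2 from rfl] at h₂ b
      rw [show k + 1 + 2 = k + 3 from rfl]
      omega

end MainLowerBound

/-! ### Optimal strategies that use only colours not yet excluded. -/

section Strategies

variable {C : Type} [Fintype C] [DecidableEq C]

/-- Some strategy that avoids excluded colours finds all secrets in `M` with external path length
at most `L`. -/
def Achieves (M : Finset (Code 2 C)) (L : ℕ) : Prop :=
  ∃ t, Solves t M ∧ cost t M ≤ L ∧ AvoidsExcluded t M

theorem Achieves.mono {M : Finset (Code 2 C)} {L L' : ℕ} (h : Achieves M L) (hL : L ≤ L') :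
    Achieves M L' :=
  let ⟨t, h₁, h₂, h₃⟩ := h
  ⟨t, h₁, h₂.trans hL, h₃⟩

theorem achieves_of_card_eq_zero {M : Finset (Code 2 C)} (h : M.card = 0) : Achieves M 0 := by
  rw [Finset.card_eq_zero] at h
  subst h
  exact ⟨.halt, by simp [Solves], by simp [cost], by simp [AvoidsExcluded]⟩

theorem Achieves.ask {M : Finset (Code 2 C)} {q : Code 2 C} {L₁ L₂ L₃ L₄ : ℕ}
    (hq : ∀ i, IsPossibleColour M (q i)) (h₁ : Achieves (answerClass M q (0, 2)) L₁)
    (h₂ : Achieves (answerClass M q (1, 0)) L₂) (h₃ : Achieves (answerClass M q (0, 1)) L₃)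
    (h₄ : Achieves (answerClass M q (0, 0)) L₄) :
    Achieves M (M.card + L₁ + L₂ + L₃ + L₄) := by
  obtain ⟨t₁, s₁, c₁, a₁⟩ := h₁
  obtain ⟨t₂, s₂, c₂, a₂⟩ := h₂
  obtain ⟨t₃, s₃, c₃, a₃⟩ := h₃
  obtain ⟨t₄, s₄, c₄, a₄⟩ := h₄
  -- The default branch also covers `(2, 0)`, after which the game is over.
  let next : ℕ × ℕ → GameTree 2 C := fun r =>
    if r = (0, 2) then t₁ else if r = (1, 0) then t₂ else if r = (0, 1) then t₃ else t₄
  have key (s : Code 2 C) (hs : s ∈ M) (hr : answer s q ≠ (2, 0)) :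
      Solves (next (answer s q)) (answerClass M q (answer s q)) ∧
        AvoidsExcluded (next (answer s q)) (answerClass M q (answer s q)) := by
    have h : answer s q = (0, 2) ∨ answer s q = (1, 0) ∨ answer s q = (0, 1) ∨
        answer s q = (0, 0) := by
      rw [answer_two] at hr ⊢
      split_ifs at hr ⊢ <;> simp at hr ⊢
    rcases h with h | h | h | h <;> rw [h]
    · exact ⟨s₁, a₁⟩
    · exact ⟨s₂, a₂⟩
    · exact ⟨s₃, a₃⟩
    · exact ⟨s₄, a₄⟩
  have hsolve : Solves (.ask q next) M := by
    intro s hs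
    rw [questionCount]
    split_ifs with hr
    · exact ENat.one_ne_top
    · exact WithTop.add_ne_top.2
        ⟨ENat.one_ne_top, (key s hs hr).1 s (Finset.mem_filter.2 ⟨hs, rfl⟩)⟩
  refine ⟨.ask q next, hsolve, ?_, hq, fun s hs hr => (key s hs hr).2⟩
  rw [hsolve.cost_ask]
  have : cost (next (0, 2)) (answerClass M q (0, 2)) ≤ L₁ := c₁
  have : cost (next (1, 0)) (answerClass M q (1, 0)) ≤ L₂ := c₂
  have : cost (next (0, 1)) (answerClass M q (0, 1)) ≤ L₃ := c₃
  have : cost (next (0, 0)) (answerClass M q (0, 0)) ≤ L₄ := c₄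
  omega

theorem card_class_found_of_mem {M : Finset (Code 2 C)} {q : Code 2 C} (hq : q ∈ M) :
    (answerClass M q (2, 0)).card = 1 :=
  le_antisymm (card_class_found_le_one M q)
    (Finset.card_pos.2 ⟨q, mem_class_found.2 ⟨hq, rfl, rfl⟩⟩)

theorem achieves_card_of_card_le_one {M : Finset (Code 2 C)} (h : M.card ≤ 1) :
    Achieves M M.card := by
  obtain h | h := Nat.le_one_iff_eq_zero_or_eq_one.1 h
  · exact (achieves_of_card_eq_zero h).mono (Nat.zero_le _)
  · obtain ⟨q, hq⟩ := Finset.card_pos.1 (h ▸ zero_lt_one)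
    have h₀ := card_class_found_of_mem hq
    have hc := card_eq_card_answerClass M q
    exact Achieves.ask (q := q) (fun i => ⟨q, hq, i, rfl⟩)
      (achieves_of_card_eq_zero (by omega)) (achieves_of_card_eq_zero (by omega))
      (achieves_of_card_eq_zero (by omega)) (achieves_of_card_eq_zero (by omega))

theorem achieves_three_of_card_le_two {M : Finset (Code 2 C)} (h : M.card ≤ 2) :
    Achieves M 3 := by
  obtain h | h := Nat.le_or_eq_of_le_succ h
  · exact (achieves_card_of_card_le_one h).mono (by omega)
  · obtain ⟨q, hq⟩ := Finset.card_pos.1 (show 0 < M.card by omega)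
    have h₀ := card_class_found_of_mem hq
    have hc := card_eq_card_answerClass M q
    exact (Achieves.ask (q := q) (fun i => ⟨q, hq, i, rfl⟩)
      (achieves_card_of_card_le_one (by omega)) (achieves_card_of_card_le_one (by omega))
      (achieves_card_of_card_le_one (by omega)) (achieves_card_of_card_le_one (by omega))).mono
      (by omega)

/-- The free colours of two possible secrets, one put on each peg, isolate both secrets by different
answers. Both colours must differ from the common colour `a`; at most one code of the line has free
colour `a`, so three codes suffice. -/
theorem IsLine.exists_question {M : Finset (Code 2 C)} (hM : IsLine M) (h : 3 ≤ M.card) :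
    ∃ q : Code 2 C, (∀ i, IsPossibleColour M (q i)) ∧ (answerClass M q (0, 2)).card = 0 ∧
      (answerClass M q (1, 0)).card = 1 ∧ (answerClass M q (0, 1)).card = 1 ∧
      (answerClass M q (0, 0)).card + 2 = M.card := by
  obtain ⟨i, a, hM⟩ := hM
  obtain ⟨j, hij⟩ : ∃ j : Fin 2, i = 0 ∧ j = 1 ∨ i = 1 ∧ j = 0 := by
    obtain rfl | rfl : i = 0 ∨ i = 1 := by omega
    · exact ⟨1, by simp⟩
    · exact ⟨0, by simp⟩
  have hone : (M.filter fun s => s j = a).card ≤ 1 := by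
    refine card_le_one_of_forall_eq (x := a) (y := a) fun s hs => ?_
    rw [Finset.mem_filter] at hs
    grind
  have hc := card_eq_card_filter_add (M := M) j a
  obtain ⟨s₁, hs₁, s₂, hs₂, hne⟩ := Finset.one_lt_card.1
    (show 1 < (M.filter fun s => s j ≠ a).card by omega)
  rw [Finset.mem_filter] at hs₁ hs₂
  have hne' : s₁ j ≠ s₂ j := by
    intro he
    refine hne (funext fun l => ?_)
    obtain rfl | rfl : l = i ∨ l = j := by omega
    · rw [hM _ hs₁.1, hM _ hs₂.1]
    · exact he
  obtain ⟨q, hqi, hqj⟩ : ∃ q : Code 2 C, q i = s₁ j ∧ q j = s₂ j :=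
    ⟨fun l => if l = i then s₁ j else s₂ j, by simp, if_neg (by omega)⟩
  have h₀ : (answerClass M q (2, 0)).card = 0 := by
    refine card_eq_zero_of_forall_false fun s hs => ?_
    rw [mem_class_found] at hs
    grind
  have h₁ : (answerClass M q (0, 2)).card = 0 := by
    refine card_eq_zero_of_forall_false fun s hs => ?_
    rw [mem_class_swapped] at hs
    grind
  have h₂ : (answerClass M q (1, 0)).card = 1 := by
    refine Finset.card_eq_one.2 ⟨s₂, Finset.eq_singleton_iff_unique_mem.2 ⟨?_, fun s hs => ?_⟩⟩
    · rw [mem_class_black]; grind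
    · rw [mem_class_black] at hs
      funext l
      obtain rfl | rfl : l = i ∨ l = j := by omega
      · grind
      · grind
  have h₃ : (answerClass M q (0, 1)).card = 1 := by
    refine Finset.card_eq_one.2 ⟨s₁, Finset.eq_singleton_iff_unique_mem.2 ⟨?_, fun s hs => ?_⟩⟩
    · rw [mem_class_white]; grind
    · rw [mem_class_white] at hs
      funext l
      obtain rfl | rfl : l = i ∨ l = j := by omega
      · grind
      · grind
  have hc' := card_eq_card_answerClass M q
  refine ⟨q, fun l => ?_, h₁, h₂, h₃, by omega⟩
  obtain rfl | rfl : l = i ∨ l = j := by omega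
  · exact ⟨s₁, hs₁.1, j, hqi.symm⟩
  · exact ⟨s₂, hs₂.1, l, hqj.symm⟩

theorem IsLine.achieves {M : Finset (Code 2 C)} (hM : IsLine M) :
    Achieves M (lineCost M.card) := by
  induction hN : M.card using Nat.strong_induction_on generalizing M with
  | _ N ih =>
    match N with
    | 0 => exact achieves_of_card_eq_zero hN
    | 1 => exact (achieves_card_of_card_le_one hN.le).mono hN.le
    | 2 => exact achieves_three_of_card_le_two hN.le
    | N + 3 =>
      obtain ⟨q, hq, h₁, h₂, h₃, h₄⟩ := hM.exists_question (by omega)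
      refine (Achieves.ask hq (achieves_of_card_eq_zero h₁)
        (achieves_card_of_card_le_one h₂.le) (achieves_card_of_card_le_one h₃.le)
        (ih (N + 1) (by omega) (hM.mono (Finset.filter_subset _ M)) (by omega))).mono ?_
      rw [lineCost_add_two]
      omega

theorem IsLine.achieves_of_card_le {M : Finset (Code 2 C)} {r : ℕ} (hM : IsLine M)
    (hr : M.card ≤ r) : Achieves M (lineCost r) :=
  hM.achieves.mono (lineCost_mono hr)

/-- Asking a possible secret of a cross that separates its two lines. -/
theorem IsCross.achieves_find {a b d : C} {M : Finset (Code 2 C)} {r r' : ℕ}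
    (hM : IsCross a b M) (h₁ : ![a, d] ∈ M) (h₂ : ![d, b] ∈ M)
    (hr : (M.filter fun s => s 0 = a).card ≤ r + 1)
    (hr' : (M.filter fun s => s 0 ≠ a).card ≤ r' + 1) :
    Achieves M (M.card + 1 + lineCost r + lineCost r') := by
  obtain ⟨hab, hM⟩ := hM
  have hdb : d ≠ b := by simpa [hab] using hM _ h₁
  have hda : d ≠ a := by simpa [hab.symm] using hM _ h₂
  -- The question finds `![a, d]`, white isolates `![d, b]`, and black and none are the rests of the
  -- two arms.
  refine (Achieves.ask (q := ![a, d]) (L₁ := 0) (L₂ := lineCost r) (L₃ := 1)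
    (L₄ := lineCost r') (fun i => ⟨_, h₁, i, rfl⟩) ?_ ?_ ?_ ?_).mono (by omega)
  · refine achieves_of_card_eq_zero (card_eq_zero_of_forall_false fun s hs => ?_)
    rw [mem_class_swapped] at hs
    simp at hs
    grind
  · refine IsLine.achieves_of_card_le ⟨0, a, fun s hs => ?_⟩ ?_
    · rw [mem_class_black] at hs
      simp at hs
      grind
    · refine (Finset.card_le_card (t := (M.filter fun s => s 0 = a).erase ![a, d]) ?_).trans ?_
      · intro s hs
        rw [mem_class_black] at hs
        rw [Finset.mem_erase, Finset.mem_filter]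
        refine ⟨?_, hs.1, ?_⟩
        · rintro rfl
          simp at hs
        · simp at hs
          grind
      · rw [Finset.card_erase_of_mem (by simpa using h₁)]
        omega
  · refine (achieves_card_of_card_le_one ?_).mono ?_ <;>
    · refine card_le_one_of_forall_eq (x := d) (y := b) fun s hs => ?_
      rw [mem_class_white] at hs
      simp at hs
      grind
  · refine IsLine.achieves_of_card_le ⟨1, b, fun s hs => ?_⟩ ?_
    · rw [mem_class_none] at hs
      simp at hs
      grind
    · refine (Finset.card_le_card (t := (M.filter fun s => s 0 ≠ a).erase ![d, b]) ?_).trans ?_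
      · intro s hs
        rw [mem_class_none] at hs
        rw [Finset.mem_erase, Finset.mem_filter]
        refine ⟨?_, hs.1, hs.2.1⟩
        rintro rfl
        simp at hs
      · rw [Finset.card_erase_of_mem (by simpa [hda] using h₂)]
        omega

/-- Separating the two lines of a cross with the help of a code of one colour. -/
theorem IsCross.achieves_separate {a b c : C} {M : Finset (Code 2 C)} {r r' : ℕ}
    (hM : IsCross a b M) (h₀ : ![a, a] ∈ M) (h₁ : ![a, c] ∈ M) (h₂ : ![c, b] ∈ M)
    (hr : (M.filter fun s => s 0 = a).card ≤ r + 2)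
    (hr' : (M.filter fun s => s 0 ≠ a).card ≤ r' + 1) :
    Achieves M (M.card + 4 + lineCost r + lineCost r') := by
  obtain ⟨hab, hM⟩ := hM
  have hcb : c ≠ b := by simpa [hab] using hM _ h₁
  have hca : c ≠ a := by simpa [hab.symm] using hM _ h₂
  -- Here three codes leave the arms: `![a, c]` is swapped, and black leaves the pair `![a, a]`,
  -- `![c, b]` of cost 3. Both colours of the question occur in `![a, c]`, on the opposite pegs.
  refine (Achieves.ask (q := ![c, a]) (L₁ := 1) (L₂ := 3) (L₃ := lineCost r)
    (L₄ := lineCost r') (fun i => ⟨_, h₁, 1 - i, ?_⟩) ?_ ?_ ?_ ?_).mono (by omega)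
  · obtain rfl | rfl : i = 0 ∨ i = 1 := by omega
    · rfl
    · rfl
  · refine (achieves_card_of_card_le_one ?_).mono ?_ <;>
    · refine card_le_one_of_forall_eq (x := a) (y := c) fun s hs => ?_
      rw [mem_class_swapped] at hs
      simp at hs
      grind
  · refine achieves_three_of_card_le_two (card_le_two_of_forall_eq_or_eq (x := a) (y := a)
      (x' := c) (y' := b) fun s hs => ?_)
    rw [mem_class_black] at hs
    simp at hs
    grind
  · refine IsLine.achieves_of_card_le ⟨0, a, fun s hs => ?_⟩ ?_
    · rw [mem_class_white] at hs
      simp at hs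
      grind
    · refine (Finset.card_le_card
        (t := ((M.filter fun s => s 0 = a).erase ![a, c]).erase ![a, a]) ?_).trans ?_
      · intro s hs
        rw [mem_class_white] at hs
        rw [Finset.mem_erase, Finset.mem_erase, Finset.mem_filter]
        refine ⟨?_, ?_, hs.1, ?_⟩
        · rintro rfl
          simp at hs
        · rintro rfl
          simp [hca.symm] at hs
        · simp at hs
          grind
      · rw [Finset.card_erase_of_mem, Finset.card_erase_of_mem (by simpa using h₁)]
        · omega
        · rw [Finset.mem_erase, Finset.mem_filter]
          exact ⟨fun he => hca (congrFun he 1).symm, h₀, rfl⟩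
  · refine IsLine.achieves_of_card_le ⟨1, b, fun s hs => ?_⟩ ?_
    · rw [mem_class_none] at hs
      simp at hs
      grind
    · refine (Finset.card_le_card (t := (M.filter fun s => s 0 ≠ a).erase ![c, b]) ?_).trans ?_
      · intro s hs
        rw [mem_class_none] at hs
        rw [Finset.mem_erase, Finset.mem_filter]
        refine ⟨?_, hs.1, ?_⟩
        · rintro rfl
          simp at hs
        · simp at hs
          grind
      · rw [Finset.card_erase_of_mem (by simpa [hca] using h₂)]
        omega

theorem card_row_class_black_le (S : Finset C) {a b : C} :
    ((answerClass (codesOver 2 S) ![a, b] (1, 0)).filter fun s => s 0 = a).card ≤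
      (S.erase b).card := by
  refine card_le_of_forall_eq_of_mem (i := 0) (j := 1) (a := a) (by simp) fun s hs => ?_
  rw [Finset.mem_filter, mem_class_black, mem_codesOver_two] at hs
  simp at hs
  grind

theorem card_col_class_black_le (S : Finset C) {a b : C} :
    ((answerClass (codesOver 2 S) ![a, b] (1, 0)).filter fun s => s 0 ≠ a).card ≤
      (S.erase a).card := by
  refine card_le_of_forall_eq_of_mem (i := 1) (j := 0) (a := b) (by simp) fun s hs => ?_
  rw [Finset.mem_filter, mem_class_black, mem_codesOver_two] at hs
  simp at hs
  grind

theorem card_row_class_white_le (S : Finset C) {a b : C} :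
    ((answerClass (codesOver 2 S) ![a, b] (0, 1)).filter fun s => s 0 = b).card ≤
      ((S.erase a).erase b).card := by
  refine card_le_of_forall_eq_of_mem (i := 0) (j := 1) (a := b) (by simp) fun s hs => ?_
  rw [Finset.mem_filter, mem_class_white, mem_codesOver_two] at hs
  simp at hs
  grind

theorem card_col_class_white_le (S : Finset C) {a b : C} :
    ((answerClass (codesOver 2 S) ![a, b] (0, 1)).filter fun s => s 0 ≠ b).card ≤
      ((S.erase a).erase b).card := by
  refine card_le_of_forall_eq_of_mem (i := 1) (j := 0) (a := a) (by simp) fun s hs => ?_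
  rw [Finset.mem_filter, mem_class_white, mem_codesOver_two] at hs
  simp at hs
  grind

/-- From five colours on, the bound for the black cross is met by `IsCross.achieves_separate`, which
leaves arms of `m + 2` and `m + 3` codes. -/
theorem blackCost_add_five (m : ℕ) :
    blackCost (m + 5) = 2 * m + 12 + lineCost (m + 2) + lineCost (m + 3) := by
  have h := two_mul_blackCost m
  obtain ⟨k, rfl | rfl⟩ := m.even_or_odd'
  · rw [lineCost_even, show 2 * k + 3 = 2 * (k + 1) + 1 by ring, lineCost_odd]
    nlinarith
  · rw [show 2 * k + 1 + 2 = 2 * (k + 1) + 1 by ring, lineCost_odd,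
      show 2 * k + 1 + 3 = 2 * (k + 1) + 2 by ring, lineCost_even]
    nlinarith

theorem achieves_class_black {S : Finset C} {a b : C} {m : ℕ} (ha : a ∈ S) (hb : b ∈ S)
    (hab : a ≠ b) (hm : S.card = m + 2) :
    Achieves (answerClass (codesOver 2 S) ![a, b] (1, 0)) (blackCost (m + 2)) := by
  obtain ⟨-, hm', -, hcard, -⟩ := card_answerClass_of_ne (q := ![a, b]) ha hb hab hm
  have hcross := isCross_class_black (S := S) (q := ![a, b]) hab
  have hr := card_row_class_black_le S (a := a) (b := b)
  have hr' := card_col_class_black_le S (a := a) (b := b)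
  rw [Finset.card_erase_of_mem hb, hm] at hr
  rw [Finset.card_erase_of_mem ha, hm] at hr'
  rcases m with _ | m
  · exact achieves_three_of_card_le_two hcard.le
  obtain ⟨c, hc⟩ : ((S.erase a).erase b).Nonempty :=
    Finset.card_pos.1 (lt_of_lt_of_eq (Nat.succ_pos m) hm'.symm)
  obtain ⟨hcb, hca, hc⟩ : c ≠ b ∧ c ≠ a ∧ c ∈ S := by simpa using hc
  have h₁ : ![a, c] ∈ answerClass (codesOver 2 S) ![a, b] (1, 0) := by
    rw [mem_class_black, mem_codesOver_two]
    simp [ha, hc, hcb]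
  have h₂ : ![c, b] ∈ answerClass (codesOver 2 S) ![a, b] (1, 0) := by
    rw [mem_class_black, mem_codesOver_two]
    simp [hb, hc, hca]
  rcases m with _ | _ | m
  -- For three and four colours the arms are so short that finding is cheaper than separating; this
  -- is the exception in `blackCost`.
  · exact (hcross.achieves_find h₁ h₂ (r := 1) (r' := 1) hr hr').mono (by rw [hcard]; decide)
  · exact (hcross.achieves_find h₁ h₂ (r := 2) (r' := 2) hr hr').mono (by rw [hcard]; decide)
  · have h₀ : ![a, a] ∈ answerClass (codesOver 2 S) ![a, b] (1, 0) := by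
      rw [mem_class_black, mem_codesOver_two]
      simp [ha, hab]
    refine (hcross.achieves_separate h₀ h₁ h₂ (r := m + 2) (r' := m + 3) hr hr').mono ?_
    rw [hcard, show m + 1 + 1 + 1 + 2 = m + 5 by ring, blackCost_add_five]
    omega

theorem achieves_class_white {S : Finset C} {a b : C} {m : ℕ} (ha : a ∈ S) (hb : b ∈ S)
    (hab : a ≠ b) (hm : S.card = m + 2) :
    Achieves (answerClass (codesOver 2 S) ![a, b] (0, 1)) (whiteCost m) := by
  obtain ⟨-, hm', -, -, hcard⟩ := card_answerClass_of_ne (q := ![a, b]) ha hb hab hm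
  have hcross := isCross_class_white (S := S) (q := ![a, b]) hab
  have hr := (card_row_class_white_le S (a := a) (b := b)).trans hm'.le
  have hr' := (card_col_class_white_le S (a := a) (b := b)).trans hm'.le
  rcases m with _ | m
  · exact achieves_of_card_eq_zero hcard
  obtain ⟨c, hc⟩ : ((S.erase a).erase b).Nonempty :=
    Finset.card_pos.1 (lt_of_lt_of_eq (Nat.succ_pos m) hm'.symm)
  obtain ⟨hcb, hca, hc⟩ : c ≠ b ∧ c ≠ a ∧ c ∈ S := by simpa using hc
  refine (hcross.achieves_find (d := c) ?_ ?_ hr hr').mono ?_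
  · rw [mem_class_white, mem_codesOver_two]
    simp [hb, hc, hca, hcb, hab.symm]
  · rw [mem_class_white, mem_codesOver_two]
    simp [ha, hc, hca, hcb, hab]
  · rw [hcard, whiteCost]
    omega

/-- Upper bound for the game in which exactly the colours in `S` are possible. -/
theorem achieves_codesOver (S : Finset C) : Achieves (codesOver 2 S) (totalCost S.card) := by
  induction hm : S.card using Nat.strong_induction_on generalizing S with
  | _ m ih =>
    match m with
    | 0 => exact achieves_of_card_eq_zero (by rw [card_codesOver_two, hm]; rfl)
    | 1 =>
      have h : (codesOver 2 S).card = 1 := by rw [card_codesOver_two, hm]; rfl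
      exact (achieves_card_of_card_le_one h.le).mono h.le
    | m + 2 =>
      obtain ⟨a, ha, b, hb, hab⟩ := Finset.one_lt_card.1 (show 1 < S.card by omega)
      obtain ⟨hnone, hm', h₁, -, -⟩ :=
        card_answerClass_of_ne (q := ![a, b]) ha hb hab hm
      have hrec := ih m (by omega) _ hm'
      rw [← hnone] at hrec
      refine (Achieves.ask (q := ![a, b]) (fun i => ?_)
        (achieves_card_of_card_le_one h₁.le)
        (achieves_class_black ha hb hab hm) (achieves_class_white ha hb hab hm) hrec).mono ?_
      · refine ⟨![a, b], ?_, i, rfl⟩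
        rw [mem_codesOver_two]
        exact ⟨ha, hb⟩
      · rw [h₁, card_codesOver_two, hm, totalCost]

end Strategies

/-! ### From path lengths to expected values, for all variants of the game. -/

theorem isLeast_expectedCounts {C : Type} [Fintype C] [DecidableEq C] (S : Finset C)
    {T : Set (GameTree 2 C)} (hT : ∀ t, AvoidsExcluded t (codesOver 2 S) → t ∈ T) :
    IsLeast (expectedCounts (codesOver 2 S) T)
      ((totalCost S.card : ℝ) / ((S.card ^ 2 : ℕ) : ℝ)) := by
  constructor
  -- The optimal strategy avoids excluded colours, so it belongs to every admissible `T`; the lower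
  -- bound ignores `T`.
  · obtain ⟨t, hs, hc, ha⟩ := achieves_codesOver S
    refine ⟨t, hT t ha, totalCost S.card, ?_, by rw [card_codesOver_two]⟩
    rw [externalPathLength_eq_coe hs, le_antisymm hc (totalCost_le_cost hs)]
  · rintro x ⟨t, -, L, hL, rfl⟩
    have hs : Solves t (codesOver 2 S) :=
      solves_of_externalPathLength_ne_top (hL ▸ ENat.natCast_ne_top L)
    rw [externalPathLength_eq_coe hs, Nat.cast_inj] at hL
    rw [card_codesOver_two, ← hL]
    have := totalCost_le_cost hs
    gcongr

theorem totalCost_div_eq (n : ℕ) (hn : 3 ≤ n) :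
    (totalCost n : ℝ) / ((n ^ 2 : ℕ) : ℝ) =
      if Even n then (8 * (n : ℝ) ^ 3 + 51 * (n : ℝ) ^ 2 - 74 * (n : ℝ) + 48) / (24 * (n : ℝ) ^ 2)
      else (8 * (n : ℝ) ^ 3 + 51 * (n : ℝ) ^ 2 - 80 * (n : ℝ) + 69) / (24 * (n : ℝ) ^ 2) := by
  have hn₀ : (n : ℝ) ≠ 0 := by positivity
  push_cast
  split_ifs with h
  · obtain ⟨k, rfl⟩ : ∃ k, n = 2 * k + 4 := by
      obtain ⟨j, rfl⟩ := h
      exact ⟨j - 2, by omega⟩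
    have := congrArg (Nat.cast : ℕ → ℝ) (totalCost_even k)
    rw [div_eq_div_iff (by positivity) (by positivity)]
    push_cast at this ⊢
    linear_combination (2 * (k : ℝ) + 4) ^ 2 * this
  · obtain ⟨k, rfl⟩ : ∃ k, n = 2 * k + 3 := by
      obtain ⟨j, rfl⟩ := Nat.not_even_iff_odd.1 h
      exact ⟨j - 1, by omega⟩
    have := congrArg (Nat.cast : ℕ → ℝ) (totalCost_odd k)
    rw [div_eq_div_iff (by positivity) (by positivity)]
    push_cast at this ⊢
    linear_combination (2 * (k : ℝ) + 3) ^ 2 * this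

end Mastermind

theorem mainTheorem1 (n : ℕ) (hn : 3 ≤ n) :
    Mastermind.MMe 2 n =
        (if Even n then (8 * (n : ℝ) ^ 3 + 51 * (n : ℝ) ^ 2 - 74 * (n : ℝ) + 48) / (24 * (n : ℝ) ^ 2)
          else (8 * (n : ℝ) ^ 3 + 51 * (n : ℝ) ^ 2 - 80 * (n : ℝ) + 69) / (24 * (n : ℝ) ^ 2)) ∧
      IsLeast (Mastermind.standardCounts 2 n) (Mastermind.MMe 2 n) ∧
      IsLeast (Mastermind.additionalCounts 2 n) (Mastermind.MMe 2 n) ∧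
      IsLeast (Mastermind.restrictedCounts 2 n) (Mastermind.MMe 2 n) := by
  have standard := Mastermind.isLeast_expectedCounts (Finset.univ : Finset (Fin n))
    (T := Set.univ) fun _ _ => Set.mem_univ _
  have additional := Mastermind.isLeast_expectedCounts
    ((Finset.univ : Finset (Option (Fin n))).erase none) (T := Set.univ) fun _ _ => Set.mem_univ _
  have restricted := Mastermind.isLeast_expectedCounts (Finset.univ : Finset (Fin n))
    (T := {t | Mastermind.AvoidsExcluded t (Mastermind.codesOver 2 Finset.univ)}) fun _ h => h
  rw [Finset.card_univ, Fintype.card_fin] at standard restricted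
  rw [Finset.card_erase_of_mem (Finset.mem_univ _), Finset.card_univ, Fintype.card_option,
    Fintype.card_fin, Nat.add_sub_cancel] at additional
  have hMMe : Mastermind.MMe 2 n = (Mastermind.totalCost n : ℝ) / ((n ^ 2 : ℕ) : ℝ) :=
    standard.csInf_eq
  rw [hMMe]
  exact ⟨Mastermind.totalCost_div_eq n hn, standard, additional, restricted⟩
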